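/- Let $A\ge 2$, let $F_1,\dots,F_A:\{1,2,\dots\}\to(0,\infty)$ be feedback functions and let $X(0)\in\{1,2,\dots\}^A$. Let $(X(n))_{n\ge 0}=(X_1(n),\dots,X_A(n))_{n\ge0}$ be the generalized Pólya urn started in the deterministic configuration $X(0)$, i.e. the discrete-time Markov chain on $\{1,2,\dots\}^A$ with $$\mathbb P\big(X(n+1)=X(n)+e^{(i)}\,\big|\,X(n)\big)=\frac{F_i(X_i(n))}{F_1(X_1(n))+\dots+F_A(X_A(n))},\qquad i=1,\dots,A,$$ where $e^{(i)}$ is the $i$-th unit vector. Put $X_i(\infty)=\lim_{n\to\infty}X_i(n)\in\{1,2,\dots\}\cup\{\infty\}$. Call a colour $i$ explosive if $\sum_{k=1}^\infty 1/F_i(k)<\infty$, and let $M\subseteq\{1,\dots,A\}$ be the set of explosive colours. Suppose that $M\neq\emptyset$, that $1\notin M$, that $\lim_{k\to\infty}F_1(k)=\infty$, and that $F_i$ is strictly monotone for every $i\in M$. Then $$-\log \mathbb P\big(X_1(\infty)>x\big)\;\sim\; d\sum_{k=X_1(0)}^{x}\frac1{F_1(k)}\qquad(x\to\infty,\ x\in\mathbb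 N),\qquad\text{where } d=\sum_{i\in M}F_i(X_i(0)),$$ and $a_x\sim b_x$ means that $a_x/b_x\to1$. -/

import Mathlib

open Filter Topology MeasureTheory

/-- A feedback function `f : {1, 2, …} → (0, ∞)`, written as a function on `ℕ` whose value at `0`
is never used. -/
def IsFeedback (f : ℕ → ℝ) : Prop := ∀ k, 1 ≤ k → 0 < f k

/-- The explosion (monopoly) condition `∑_{k ≥ 1} 1 / f k < ∞`. -/
def SatisfiesExplosion (f : ℕ → ℝ) : Prop := Summable fun k : ℕ => 1 / f (k + 1)

open Classical in
/-- The set `M` of explosive colours (possible monopolists). -/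
noncomputable def explosiveColours {A : ℕ} (F : Fin A → ℕ → ℝ) : Finset (Fin A) :=
  Finset.univ.filter fun i => SatisfiesExplosion (F i)

/-- `f` is strictly monotone on `{1, 2, …}`. -/
def IsStrictlyMonotone (f : ℕ → ℝ) : Prop :=
  StrictMonoOn f (Set.Ici 1) ∨ StrictAntiOn f (Set.Ici 1)

/-- The event that the first `n + 1` configurations of the process `X` are `h 0, …, h n`. -/
def historyEvent {A : ℕ} {Ω : Type*} (X : ℕ → Ω → Fin A → ℕ) (h : ℕ → Fin A → ℕ) (n : ℕ) :
    Set Ω :=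
  {ω | ∀ m ≤ n, X m ω = h m}

/-- `X` is, under the probability measure `P`, a generalized Pólya urn with `A` colours, feedback
functions `F i` and initial configuration `x₀`: a discrete-time Markov chain started in `x₀` which,
whatever its past, moves from `v` to `v + e⁽ⁱ⁾` with probability `F i (v i) / ∑ j, F j (v j)`.
`X n ω i` is the number of balls of colour `i` at time `n`. The identity
`P(H ∩ E) = P(H) * p` says that `P(E | H) = p` for every past `H` of positive probability. -/
structure IsPolyaUrn {A : ℕ} {Ω : Type*} [MeasurableSpace Ω] (P : Measure Ω)
    (F : Fin A → ℕ → ℝ) (x₀ : Fin A → ℕ) (X : ℕ → Ω → Fin A → ℕ) : Prop where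
  measurable : ∀ n, Measurable (X n)
  initial : ∀ᵐ ω ∂P, X 0 ω = x₀
  transition : ∀ (n : ℕ) (h : ℕ → Fin A → ℕ) (i : Fin A),
    P.real (historyEvent X h n ∩ {ω | X (n + 1) ω = h n + Pi.single i 1}) =
      P.real (historyEvent X h n) * (F i (h n i) / ∑ j, F j (h n j))

/-- The final number of balls `X_i(∞) = lim_{n → ∞} X_i(n) ∈ ℕ ∪ {∞}` of colour `i`. As the number
of balls of a colour never decreases (almost surely), the limit is the supremum. -/
noncomputable def finalCount {A : ℕ} {Ω : Type*} (X : ℕ → Ω → Fin A → ℕ) (i : Fin A) (ω : Ω) :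
    ℕ∞ :=
  ⨆ n, (X n ω i : ℕ∞)

theorem tendsto_finalCount {A : ℕ} {Ω : Type*} (X : ℕ → Ω → Fin A → ℕ) (i : Fin A) (ω : Ω)
    (hmono : Monotone fun n => X n ω i) :
    Tendsto (fun n => (X n ω i : ℕ∞)) atTop (𝓝 (finalCount X i ω)) :=
  tendsto_atTop_iSup fun _ _ hab => Nat.cast_le.2 (hmono hab)

/-! For weights `θ` with sum zero, `growthProd F x₀ θ` is harmonic for the urn, so it yields a
martingale in which colour `c` contributes `∏ (1 + θ c / F c k)`. Put weight `d` on `c` and `-F i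
(x₀ i)` on each explosive `i`. The product then vanishes once an explosive colour is drawn, which
almost surely happens. Frozen when `c` exceeds `x`, it gives `1 ≤ ∏ (1 + d / F c k) * P(X_c(∞) > x)`
(`one_le_mul_tail`).

Scaling these weights by `s < 1` keeps the explosive factors above a positive constant, because `∑ 1
/ F i` converges. Markov's inequality then bounds the tail above by a constant over `∏ (1 + s * d /
F c k)` (`exists_mul_tail_le_one`).

Since `F c → ∞`, the logarithms of these products are comparable to `∑ 1 / F c k`. This sum
diverges, so constants are negligible, and `s → 1` closes the gap. -/

section Chain

variable {A : ℕ} {Ω : Type*} [MeasurableSpace Ω] {P : Measure Ω}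
  {F : Fin A → ℕ → ℝ} {x₀ : Fin A → ℕ} {X : ℕ → Ω → Fin A → ℕ}

theorem IsPolyaUrn.measurableSet_eq (hX : IsPolyaUrn P F x₀ X) (n : ℕ) (v : Fin A → ℕ) :
    MeasurableSet {ω | X n ω = v} :=
  hX.measurable n (measurableSet_singleton v)

/-- The one-step law of the urn, given only its present configuration. -/
theorem IsPolyaUrn.measure_step [IsFiniteMeasure P] (hX : IsPolyaUrn P F x₀ X) (n : ℕ)
    (v : Fin A → ℕ) (i : Fin A) :
    P ({ω | X n ω = v} ∩ {ω | X (n + 1) ω = v + Pi.single i 1}) =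
      P {ω | X n ω = v} * ENNReal.ofReal (F i (v i) / ∑ j, F j (v j)) := by
  -- The transition law conditions on the whole past, so split over the countably many pasts before
  -- time `n`.
  set Y : Ω → (Fin n → Fin A → ℕ) := fun ω m => X m ω with hY
  have hYm : Measurable Y := measurable_pi_lambda _ fun m => hX.measurable m
  have hdec : ∀ S : Set Ω, P S = ∑' y, P (S ∩ Y ⁻¹' {y}) := by
    intro S
    have h := tsum_measure_preimage_singleton (μ := P.restrict S) (f := Y) Set.countable_univ
      (fun y _ => hYm (measurableSet_singleton y))
    rw [Set.preimage_univ, Measure.restrict_apply_univ] at h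
    rw [← h, tsum_univ (fun y => (P.restrict S) (Y ⁻¹' {y}))]
    refine tsum_congr fun y => ?_
    rw [Measure.restrict_apply (hYm (measurableSet_singleton y)), Set.inter_comm]
  rw [hdec, hdec {ω | X n ω = v}, ← ENNReal.tsum_mul_right]
  refine tsum_congr fun y => ?_
  set h : ℕ → Fin A → ℕ := fun m => if hm : m < n then y ⟨m, hm⟩ else v with hh
  have hn : h n = v := by simp [hh]
  have hev : {ω | X n ω = v} ∩ Y ⁻¹' {y} = historyEvent X h n := by
    ext ω
    simp only [Set.mem_inter_iff, Set.mem_ofPred_eq, Set.mem_preimage, Set.mem_singleton_iff,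
      historyEvent, hY, hh, funext_iff (f := fun m : Fin n => X m ω)]
    constructor
    · rintro ⟨h1, h2⟩ m hm
      rcases hm.lt_or_eq with hm | rfl
      · simpa [hm] using h2 ⟨m, hm⟩
      · simpa using h1
    · intro h1
      refine ⟨by simpa using h1 n le_rfl, fun m => by simpa using h1 m m.2.le⟩
  have key := hX.transition n h i
  rw [hn] at key
  rw [Set.inter_right_comm, hev, ← ofReal_measureReal (measure_ne_top _ _), key,
    ENNReal.ofReal_mul measureReal_nonneg, ofReal_measureReal (measure_ne_top _ _)]

theorem IsFeedback.sum_pos {v : Fin A → ℕ} (hF : ∀ i, IsFeedback (F i)) (hv : ∀ i, 1 ≤ v i)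
    (c : Fin A) : 0 < ∑ j, F j (v j) :=
  Finset.sum_pos (fun j _ => hF j _ (hv j)) ⟨c, Finset.mem_univ _⟩

/-- The `A` transition probabilities out of `v` add up to one, leaving no mass for any other move.
-/
theorem IsPolyaUrn.ae_step_of_eq [IsFiniteMeasure P] (hX : IsPolyaUrn P F x₀ X)
    (hF : ∀ i, IsFeedback (F i)) (c : Fin A) (n : ℕ) (v : Fin A → ℕ) (hv : ∀ i, 1 ≤ v i) :
    ∀ᵐ ω ∂P, X n ω = v → ∃ i, X (n + 1) ω = v + Pi.single i 1 := by
  have hpos := IsFeedback.sum_pos hF hv c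
  set S := {ω | X n ω = v}
  set U := fun i : Fin A => S ∩ {ω | X (n + 1) ω = v + Pi.single i 1} with hU
  have hUm : ∀ i, MeasurableSet (U i) := fun i =>
    (hX.measurableSet_eq _ _).inter (hX.measurableSet_eq _ _)
  have hdisj : Pairwise (Function.onFun Disjoint U) := by
    intro i j hij
    refine Set.disjoint_left.2 fun ω hi hj => hij ?_
    have : (Pi.single i 1 : Fin A → ℕ) = Pi.single j 1 := add_left_cancel (hi.2.symm.trans hj.2)
    by_contra hne
    simpa [Pi.single_apply, hne] using congrFun this i
  have hsum : P (⋃ i, U i) = P S := by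
    rw [measure_iUnion hdisj hUm, tsum_fintype]
    simp only [hU, S, hX.measure_step]
    rw [← Finset.mul_sum, ← ENNReal.ofReal_sum_of_nonneg, ← Finset.sum_div, div_self hpos.ne',
      ENNReal.ofReal_one, mul_one]
    exact fun i _ => div_nonneg (hF i _ (hv i)).le hpos.le
  have hdiff : P (S \ ⋃ i, U i) = 0 := by
    rw [measure_sdiff (Set.iUnion_subset fun i => Set.inter_subset_left)
      (MeasurableSet.iUnion hUm).nullMeasurableSet (measure_ne_top _ _), hsum, tsub_self]
  filter_upwards [measure_eq_zero_iff_ae_notMem.1 hdiff] with ω hω hωS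
  by_contra hcon
  exact hω ⟨hωS, fun hmem => by
    obtain ⟨i, hi⟩ := Set.mem_iUnion.1 hmem
    exact hcon ⟨i, hi.2⟩⟩

theorem IsPolyaUrn.ae_step_of_ge [IsFiniteMeasure P] (hX : IsPolyaUrn P F x₀ X)
    (hF : ∀ i, IsFeedback (F i)) (hx₀ : ∀ i, 1 ≤ x₀ i) (c : Fin A) (n : ℕ) :
    ∀ᵐ ω ∂P, x₀ ≤ X n ω → ∃ i, X (n + 1) ω = X n ω + Pi.single i 1 := by
  have h : ∀ᵐ ω ∂P, ∀ v : Fin A → ℕ, x₀ ≤ v →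
      X n ω = v → ∃ i, X (n + 1) ω = v + Pi.single i 1 := by
    refine ae_all_iff.2 fun v => ?_
    by_cases hv : x₀ ≤ v
    · filter_upwards [hX.ae_step_of_eq hF c n v fun i => (hx₀ i).trans (hv i)] with ω hω _
      exact hω
    · exact Eventually.of_forall fun ω h => absurd h hv
  filter_upwards [h] with ω hω hge
  exact hω _ hge rfl

/-- Almost surely, every transition of the urn adds a single ball. -/
theorem IsPolyaUrn.ae_path [IsFiniteMeasure P] (hX : IsPolyaUrn P F x₀ X)
    (hF : ∀ i, IsFeedback (F i)) (hx₀ : ∀ i, 1 ≤ x₀ i) (c : Fin A) :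
    ∀ᵐ ω ∂P, X 0 ω = x₀ ∧ ∀ n, x₀ ≤ X n ω ∧ ∃ i, X (n + 1) ω = X n ω + Pi.single i 1 := by
  filter_upwards [hX.initial, ae_all_iff.2 fun n => hX.ae_step_of_ge hF hx₀ c n] with ω h0 hs
  have hge : ∀ n, x₀ ≤ X n ω := by
    intro n
    induction n with
    | zero => exact h0.ge
    | succ n ih =>
      obtain ⟨i, hi⟩ := hs n ih
      rw [hi]
      exact ih.trans le_self_add
  exact ⟨h0, fun n => ⟨hge n, hs n (hge n)⟩⟩

theorem IsPolyaUrn.lintegral_succ [IsFiniteMeasure P] (hX : IsPolyaUrn P F x₀ X)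
    (hF : ∀ i, IsFeedback (F i)) (hx₀ : ∀ i, 1 ≤ x₀ i) (c : Fin A) (n : ℕ)
    (φ : (Fin A → ℕ) → ENNReal) :
    ∫⁻ ω, φ (X (n + 1) ω) ∂P =
      ∫⁻ ω, ∑ i, ENNReal.ofReal (F i (X n ω i) / ∑ j, F j (X n ω j)) *
        φ (X n ω + Pi.single i 1) ∂P := by
  have hcomp : ∀ {β : Type} [MeasurableSpace β] (f : (Fin A → ℕ) → β),
      Measurable fun ω => f (X n ω) := fun f =>
    (Measurable.of_discrete (f := f)).comp (hX.measurable n)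
  have hind : ∀ i, Measurable fun ω => ({ω | X (n + 1) ω = X n ω + Pi.single i 1}).indicator
      (fun ω => φ (X n ω + Pi.single i 1)) ω := fun i =>
    Measurable.indicator (hcomp fun v => φ (v + Pi.single i 1))
      (measurableSet_eq_fun (hX.measurable _) (hcomp fun v => v + Pi.single i 1))
  have h1 : ∫⁻ ω, φ (X (n + 1) ω) ∂P = ∫⁻ ω, ∑ i,
      ({ω | X (n + 1) ω = X n ω + Pi.single i 1}).indicator
        (fun ω => φ (X n ω + Pi.single i 1)) ω ∂P := by
    refine lintegral_congr_ae ?_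
    filter_upwards [hX.ae_path hF hx₀ c] with ω hω
    obtain ⟨i, hi⟩ := (hω.2 n).2
    rw [Finset.sum_eq_single i]
    · rw [Set.indicator_of_mem (by exact hi), hi]
    · intro j _ hj
      refine Set.indicator_of_notMem ?_ _
      intro hj'
      have : (Pi.single i 1 : Fin A → ℕ) = Pi.single j 1 := add_left_cancel (hi.symm.trans hj')
      simpa [Pi.single_apply, hj] using congrFun this j
    · simp
  have h2 : ∫⁻ ω, ∑ i, ENNReal.ofReal (F i (X n ω i) / ∑ j, F j (X n ω j)) *
        φ (X n ω + Pi.single i 1) ∂P =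
      ∑ i, ∫⁻ ω, ENNReal.ofReal (F i (X n ω i) / ∑ j, F j (X n ω j)) *
        φ (X n ω + Pi.single i 1) ∂P :=
    lintegral_finsetSum _ fun i _ =>
      hcomp fun v => ENNReal.ofReal (F i (v i) / ∑ j, F j (v j)) * φ (v + Pi.single i 1)
  rw [h1, h2, lintegral_finsetSum _ fun i _ => hind i]
  refine Finset.sum_congr rfl fun i _ => ?_
  have hpart : ∀ f : Ω → ENNReal, ∫⁻ ω, f ω ∂P = ∑' v, ∫⁻ ω in {ω | X n ω = v}, f ω ∂P := by
    intro f
    rw [← lintegral_iUnion (hX.measurableSet_eq n), Set.iUnion_eq_univ_iff.2, setLIntegral_univ]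
    · exact fun ω => ⟨X n ω, rfl⟩
    · intro v w hvw
      exact Set.disjoint_left.2 fun ω hv hw => hvw (hv.symm.trans hw)
  rw [hpart, hpart (fun ω => ENNReal.ofReal _ * _)]
  refine tsum_congr fun v => ?_
  have e1 : ∫⁻ ω in {ω | X n ω = v}, ({ω | X (n + 1) ω = X n ω + Pi.single i 1}).indicator
        (fun ω => φ (X n ω + Pi.single i 1)) ω ∂P =
      ∫⁻ ω in {ω | X n ω = v}, ({ω | X (n + 1) ω = v + Pi.single i 1}).indicator
        (fun _ => φ (v + Pi.single i 1)) ω ∂P := by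
    refine setLIntegral_congr_fun (hX.measurableSet_eq n v) fun ω hω => ?_
    have hω : X n ω = v := hω
    simp [Set.indicator, hω]
  have e2 : ∫⁻ ω in {ω | X n ω = v}, ENNReal.ofReal (F i (X n ω i) / ∑ j, F j (X n ω j)) *
        φ (X n ω + Pi.single i 1) ∂P =
      ∫⁻ _ in {ω | X n ω = v}, ENNReal.ofReal (F i (v i) / ∑ j, F j (v j)) *
        φ (v + Pi.single i 1) ∂P := by
    refine setLIntegral_congr_fun (hX.measurableSet_eq n v) fun ω hω => ?_
    have hω : X n ω = v := hω
    simp [hω]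
  rw [e1, e2, lintegral_indicator_const (hX.measurableSet_eq _ _), setLIntegral_const,
    Measure.restrict_apply (hX.measurableSet_eq _ _), Set.inter_comm, hX.measure_step]
  ring

/-- The expectation of a nonnegative superharmonic function of the urn does not increase. -/
theorem IsPolyaUrn.lintegral_le_of_superharmonic [IsProbabilityMeasure P]
    (hX : IsPolyaUrn P F x₀ X) (hF : ∀ i, IsFeedback (F i)) (hx₀ : ∀ i, 1 ≤ x₀ i) (c : Fin A)
    (g : (Fin A → ℕ) → ℝ) (hg : ∀ v, x₀ ≤ v → 0 ≤ g v)
    (hsup : ∀ v, x₀ ≤ v → ∑ i, F i (v i) * g (v + Pi.single i 1) ≤ (∑ j, F j (v j)) * g v)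
    (n : ℕ) : ∫⁻ ω, ENNReal.ofReal (g (X n ω)) ∂P ≤ ENNReal.ofReal (g x₀) := by
  induction n with
  | zero =>
    rw [lintegral_congr_ae (g := fun _ => ENNReal.ofReal (g x₀))]
    · simp
    · filter_upwards [hX.initial] with ω hω
      rw [hω]
  | succ n ih =>
    rw [hX.lintegral_succ hF hx₀ c n fun v => ENNReal.ofReal (g v)]
    refine le_trans (lintegral_mono_ae ?_) ih
    filter_upwards [hX.ae_path hF hx₀ c] with ω hω
    have hge := (hω.2 n).1
    set v := X n ω
    have hv : ∀ i, 1 ≤ v i := fun i => (hx₀ i).trans (hge i)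
    have hpos := IsFeedback.sum_pos hF hv c
    have hp : ∀ i, 0 ≤ F i (v i) / ∑ j, F j (v j) := fun i =>
      div_nonneg (hF i _ (hv i)).le hpos.le
    simp_rw [← ENNReal.ofReal_mul (hp _)]
    rw [← ENNReal.ofReal_sum_of_nonneg fun i _ =>
      mul_nonneg (hp i) (hg _ (hge.trans le_self_add))]
    refine ENNReal.ofReal_le_ofReal ?_
    simp_rw [div_mul_eq_mul_div]
    rw [← Finset.sum_div, div_le_iff₀ hpos, mul_comm]
    simpa [mul_comm] using hsup v hge

/-- The expectation of a nonnegative subharmonic function of the urn does not decrease. -/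
theorem IsPolyaUrn.le_lintegral_of_subharmonic [IsProbabilityMeasure P]
    (hX : IsPolyaUrn P F x₀ X) (hF : ∀ i, IsFeedback (F i)) (hx₀ : ∀ i, 1 ≤ x₀ i) (c : Fin A)
    (g : (Fin A → ℕ) → ℝ) (hg : ∀ v, x₀ ≤ v → 0 ≤ g v)
    (hsub : ∀ v, x₀ ≤ v → (∑ j, F j (v j)) * g v ≤ ∑ i, F i (v i) * g (v + Pi.single i 1))
    (n : ℕ) : ENNReal.ofReal (g x₀) ≤ ∫⁻ ω, ENNReal.ofReal (g (X n ω)) ∂P := by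
  induction n with
  | zero =>
    rw [lintegral_congr_ae (g := fun _ => ENNReal.ofReal (g x₀))]
    · simp
    · filter_upwards [hX.initial] with ω hω
      rw [hω]
  | succ n ih =>
    rw [hX.lintegral_succ hF hx₀ c n fun v => ENNReal.ofReal (g v)]
    refine ih.trans (lintegral_mono_ae ?_)
    filter_upwards [hX.ae_path hF hx₀ c] with ω hω
    have hge := (hω.2 n).1
    set v := X n ω
    have hv : ∀ i, 1 ≤ v i := fun i => (hx₀ i).trans (hge i)
    have hpos := IsFeedback.sum_pos hF hv c
    have hp : ∀ i, 0 ≤ F i (v i) / ∑ j, F j (v j) := fun i =>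
      div_nonneg (hF i _ (hv i)).le hpos.le
    simp_rw [← ENNReal.ofReal_mul (hp _)]
    rw [← ENNReal.ofReal_sum_of_nonneg fun i _ =>
      mul_nonneg (hp i) (hg _ (hge.trans le_self_add))]
    refine ENNReal.ofReal_le_ofReal ?_
    simp_rw [div_mul_eq_mul_div]
    rw [← Finset.sum_div, le_div_iff₀ hpos, mul_comm]
    simpa [mul_comm] using hsub v hge

end Chain

/-! ### Growth of the products attached to a single colour. -/

section Products

theorem tendsto_sum_inv_of_not_explosive {f : ℕ → ℝ} (hf : IsFeedback f)
    (hexp : ¬ SatisfiesExplosion f) {a : ℕ} (ha : 1 ≤ a) :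
    Tendsto (fun m => ∑ k ∈ Finset.Ico a m, 1 / f k) atTop atTop := by
  have h1 : ¬ Summable fun k => 1 / f (a + k) := by
    intro h
    refine hexp ?_
    have h' : Summable fun k => 1 / f (k + a) := by simpa only [add_comm] using h
    exact (summable_nat_add_iff 1).2 ((summable_nat_add_iff (f := fun k => 1 / f k) a).1 h')
  rw [not_summable_iff_tendsto_nat_atTop_of_nonneg fun k =>
    one_div_nonneg.2 (hf _ (by omega)).le] at h1
  simp_rw [Finset.sum_Ico_eq_sum_range]
  exact h1.comp (tendsto_sub_atTop_nat a)

theorem one_add_sum_le_prod {f : ℕ → ℝ} (hf : IsFeedback f) {θ : ℝ} (hθ : 0 ≤ θ) {a : ℕ}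
    (ha : 1 ≤ a) (m : ℕ) :
    1 + θ * ∑ k ∈ Finset.Ico a m, 1 / f k ≤ ∏ k ∈ Finset.Ico a m, (1 + θ / f k) := by
  induction m with
  | zero => simp
  | succ m ih =>
    rcases le_or_gt a m with ham | ham
    · have hq : 0 ≤ θ / f m := div_nonneg hθ (hf m (ha.trans ham)).le
      have hs : 0 ≤ θ * ∑ k ∈ Finset.Ico a m, 1 / f k :=
        mul_nonneg hθ (Finset.sum_nonneg fun k hk =>
          one_div_nonneg.2 (hf k (ha.trans (Finset.mem_Ico.1 hk).1)).le)
      rw [Finset.sum_Ico_succ_top ham, Finset.prod_Ico_succ_top ham, mul_add, mul_one_div]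
      nlinarith [mul_nonneg hs hq, mul_le_mul_of_nonneg_right ih hq]
    · simp [Finset.Ico_eq_empty_of_le (show m + 1 ≤ a from ham)]

/-- Each factor equals `1 / (1 + θ / (f k - θ))`, hence is at least `exp (-θ / (f k - θ))`, and
these exponents are summable. Strictness of `θ < f a` keeps the first factor away from zero. -/
theorem exists_pos_le_prod_of_explosive {f : ℕ → ℝ} (hf : IsFeedback f)
    (hexp : SatisfiesExplosion f) {a : ℕ} (ha : 1 ≤ a) (hle : ∀ k, a ≤ k → f a ≤ f k)
    {θ : ℝ} (hθ : 0 ≤ θ) (hθa : θ < f a) :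
    ∃ b, 0 < b ∧ ∀ m, b ≤ ∏ k ∈ Finset.Ico a m, (1 + -θ / f k) := by
  have hs : Summable fun k => |1 / f k| := 
    ((summable_nat_add_iff (f := fun k => 1 / f k) 1).1 hexp).abs
  have hfa : 0 < f a := hf a ha
  -- `t / (t - θ)` decreases in `t > θ`, so its value at `f a` gives `θ / (f k - θ) ≤ C / f k` for
  -- all `k ≥ a`.
  set C := θ * f a / (f a - θ) with hC
  have hC0 : 0 ≤ C := div_nonneg (mul_nonneg hθ hfa.le) (sub_pos.2 hθa).le
  refine ⟨Real.exp (-(C * ∑' k, |1 / f k|)), Real.exp_pos _, fun m => ?_⟩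
  have hsum : ∑ k ∈ Finset.Ico a m, |1 / f k| ≤ ∑' k, |1 / f k| :=
    hs.sum_le_tsum _ fun _ _ => abs_nonneg _
  calc Real.exp (-(C * ∑' k, |1 / f k|))
      ≤ Real.exp (∑ k ∈ Finset.Ico a m, -(C * |1 / f k|)) := by
        rw [Real.exp_le_exp, Finset.sum_neg_distrib, ← Finset.mul_sum]
        exact neg_le_neg (mul_le_mul_of_nonneg_left hsum hC0)
    _ = ∏ k ∈ Finset.Ico a m, Real.exp (-(C * |1 / f k|)) := Real.exp_sum _ _
    _ ≤ _ := by
        refine Finset.prod_le_prod (fun _ _ => (Real.exp_pos _).le) fun k hk => ?_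
        have hk := (Finset.mem_Ico.1 hk).1
        have hfk : 0 < f k := hf k (ha.trans hk)
        have hlt : θ < f k := hθa.trans_le (hle k hk)
        rw [abs_of_pos (one_div_pos.2 hfk), Real.exp_neg]
        have h1 : 1 + -θ / f k = (f k / (f k - θ))⁻¹ := by
          field_simp
          ring
        rw [h1]
        refine inv_anti₀ (div_pos hfk (sub_pos.2 hlt)) ?_
        refine le_trans ?_ (Real.add_one_le_exp _)
        have h2 : f k / (f k - θ) = θ / (f k - θ) + 1 := by
          have := (sub_pos.2 hlt).ne'
          field_simp
          ring
        rw [h2, hC, mul_one_div, div_div]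
        gcongr ?_ + 1
        rw [div_le_div_iff₀ (sub_pos.2 hlt) (mul_pos (sub_pos.2 hθa) hfk)]
        nlinarith [mul_nonneg hθ (mul_nonneg hθ (sub_nonneg.2 (hle k hk)))]

/-- A decreasing `f` would keep `1 / f` above `1 / f 1`, against summability; so `f` increases. -/
theorem IsStrictlyMonotone.le_of_explosive {f : ℕ → ℝ} (hmono : IsStrictlyMonotone f)
    (hf : IsFeedback f) (hexp : SatisfiesExplosion f) {a k : ℕ} (ha : 1 ≤ a) (hk : a ≤ k) :
    f a ≤ f k := by
  rcases hmono with h | h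
  · exact h.monotoneOn (Set.mem_Ici.2 ha) (Set.mem_Ici.2 (ha.trans hk)) hk
  · exfalso
    have h0 : Tendsto (fun k : ℕ => 1 / f (k + 1)) atTop (𝓝 0) := hexp.tendsto_atTop_zero
    have h1 : ∀ k : ℕ, 1 / f 1 ≤ 1 / f (k + 1) := fun k =>
      one_div_le_one_div_of_le (hf _ (by omega))
        (h.antitoneOn (Set.mem_Ici.2 le_rfl) (Set.mem_Ici.2 (Nat.le_add_left 1 k)) (Nat.le_add_left 1 k))
    exact (one_div_pos.2 (hf 1 le_rfl)).not_ge (ge_of_tendsto' h0 h1)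

end Products

/-! ### The harmonic product. -/

/-- The product `∏ i, ∏ k ∈ [x₀ i, v i), (1 + θ i / F i k)`, which is a harmonic function of the
urn when `∑ i, θ i = 0`. -/
noncomputable def growthProd {A : ℕ} (F : Fin A → ℕ → ℝ) (x₀ : Fin A → ℕ) (θ : Fin A → ℝ)
    (v : Fin A → ℕ) : ℝ :=
  ∏ i, ∏ k ∈ Finset.Ico (x₀ i) (v i), (1 + θ i / F i k)

section Growth

variable {A : ℕ} {F : Fin A → ℕ → ℝ} {x₀ : Fin A → ℕ} {θ : Fin A → ℝ}

theorem growthProd_self : growthProd F x₀ θ x₀ = 1 := by simp [growthProd]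

theorem growthProd_nonneg (hθ : ∀ i k, x₀ i ≤ k → 0 ≤ 1 + θ i / F i k) (v : Fin A → ℕ) :
    0 ≤ growthProd F x₀ θ v :=
  Finset.prod_nonneg fun i _ => Finset.prod_nonneg fun k hk => hθ i k (Finset.mem_Ico.1 hk).1

theorem growthProd_add_single {v : Fin A → ℕ} (hv : x₀ ≤ v) (i : Fin A) :
    growthProd F x₀ θ (v + Pi.single i 1) = growthProd F x₀ θ v * (1 + θ i / F i (v i)) := by
  unfold growthProd
  rw [← Finset.mul_prod_erase _ _ (Finset.mem_univ i),
    ← Finset.mul_prod_erase _ (fun j => ∏ k ∈ Finset.Ico (x₀ j) (v j), _) (Finset.mem_univ i)]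
  have h : ∏ j ∈ Finset.univ.erase i, ∏ k ∈ Finset.Ico (x₀ j) ((v + Pi.single i 1 : Fin A → ℕ) j),
      (1 + θ j / F j k) =
      ∏ j ∈ Finset.univ.erase i, ∏ k ∈ Finset.Ico (x₀ j) (v j), (1 + θ j / F j k) := by
    refine Finset.prod_congr rfl fun j hj => ?_
    simp [Finset.ne_of_mem_erase hj]
  rw [h, Pi.add_apply, Pi.single_eq_same, Finset.prod_Ico_succ_top (hv i)]
  ring

/-- The drawing weight `F i (v i)` cancels the denominator in the new factor `1 + θ i / F i (v i)`,
leaving the excess `θ i` times the product; these excesses sum to zero. -/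
theorem sum_mul_growthProd_add_single (hF : ∀ i, IsFeedback (F i)) (hx₀ : ∀ i, 1 ≤ x₀ i)
    (hθ : ∑ i, θ i = 0) {v : Fin A → ℕ} (hv : x₀ ≤ v) :
    ∑ i, F i (v i) * growthProd F x₀ θ (v + Pi.single i 1) =
      (∑ i, F i (v i)) * growthProd F x₀ θ v := by
  have h : ∀ i, F i (v i) * growthProd F x₀ θ (v + Pi.single i 1) =
      F i (v i) * growthProd F x₀ θ v + θ i * growthProd F x₀ θ v := fun i => by
    have := (hF i (v i) ((hx₀ i).trans (hv i))).ne'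
    rw [growthProd_add_single hv]
    field_simp
  simp_rw [h, Finset.sum_add_distrib, ← Finset.sum_mul, hθ, zero_mul, add_zero]

end Growth

/-! ### Two-sided bounds on the tail of the final count. -/

theorem finalCount_tail_eq {A : ℕ} {Ω : Type*} {X : ℕ → Ω → Fin A → ℕ} (x : ℕ) (c : Fin A) :
    {ω | (x : ℕ∞) < finalCount X c ω} = ⋃ n, {ω | x < X n ω c} := by
  ext ω
  simp [finalCount, lt_iSup_iff]

section Tail

variable {A : ℕ} {Ω : Type*} [MeasurableSpace Ω] {P : Measure Ω}
  {F : Fin A → ℕ → ℝ} {x₀ : Fin A → ℕ} {X : ℕ → Ω → Fin A → ℕ}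

theorem IsPolyaUrn.ae_sum_eq [IsFiniteMeasure P] (hX : IsPolyaUrn P F x₀ X)
    (hF : ∀ i, IsFeedback (F i)) (hx₀ : ∀ i, 1 ≤ x₀ i) (c : Fin A) :
    ∀ᵐ ω ∂P, ∀ n, ∑ i, X n ω i = ∑ i, x₀ i + n := by
  filter_upwards [hX.ae_path hF hx₀ c] with ω hω n
  induction n with
  | zero => simp [hω.1]
  | succ n ih =>
    obtain ⟨i, hi⟩ := (hω.2 n).2
    simp only [hi, Pi.add_apply, Finset.sum_add_distrib, ih, Finset.sum_pi_single',
      Finset.mem_univ, if_true]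
    ring

/-- Markov's inequality for the martingale `growthProd F x₀ θ (X n)`. -/
theorem IsPolyaUrn.mul_measure_le_one [IsProbabilityMeasure P] (hX : IsPolyaUrn P F x₀ X)
    (hF : ∀ i, IsFeedback (F i)) (hx₀ : ∀ i, 1 ≤ x₀ i) (c : Fin A) {θ : Fin A → ℝ}
    (hθ : ∑ i, θ i = 0) (hθ0 : ∀ i k, x₀ i ≤ k → 0 ≤ 1 + θ i / F i k) (n : ℕ)
    {Q : (Fin A → ℕ) → Prop} {R : ℝ} (hR : ∀ v, x₀ ≤ v → ∑ i, v i = ∑ i, x₀ i + n → Q v →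
      R ≤ growthProd F x₀ θ v) :
    ENNReal.ofReal R * P {ω | Q (X n ω)} ≤ 1 := by
  have h := hX.lintegral_le_of_superharmonic hF hx₀ c (growthProd F x₀ θ)
    (fun v _ => growthProd_nonneg hθ0 v)
    (fun v hv => (sum_mul_growthProd_add_single hF hx₀ hθ hv).le) n
  rw [growthProd_self, ENNReal.ofReal_one] at h
  refine le_trans ?_ h
  refine le_trans ?_ (mul_meas_ge_le_lintegral ((Measurable.of_discrete
    (f := fun v => ENNReal.ofReal (growthProd F x₀ θ v))).comp (hX.measurable n))
    (ENNReal.ofReal R))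
  refine mul_le_mul' le_rfl ?_
  refine measure_mono_ae ?_
  filter_upwards [hX.ae_path hF hx₀ c, hX.ae_sum_eq hF hx₀ c] with ω h1 h2 hQ
  exact ENNReal.ofReal_le_ofReal (hR _ (h1.2 n).1 (h2 n) hQ)

/-- Almost surely, some colour of `M` is drawn eventually, if no other colour is explosive. -/
theorem IsPolyaUrn.tendsto_measure_stuck [IsProbabilityMeasure P] (hX : IsPolyaUrn P F x₀ X)
    (hF : ∀ i, IsFeedback (F i)) (hx₀ : ∀ i, 1 ≤ x₀ i) {c : Fin A} {M : Finset (Fin A)}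
    (hM : M.Nonempty) (hcM : c ∉ M) (hexp : ∀ j, j ∉ M → ¬ SatisfiesExplosion (F j))
    (hle : ∀ i ∈ M, ∀ k, x₀ i ≤ k → F i (x₀ i) ≤ F i k) :
    Tendsto (fun n => P {ω | ∀ i ∈ M, X n ω i = x₀ i}) atTop (𝓝 0) := by
  set d := ∑ i ∈ M, F i (x₀ i) with hd
  have hd0 : 0 < d := Finset.sum_pos (fun i _ => hF i _ (hx₀ i)) hM
  have hcard : 0 < (Mᶜ.card : ℝ) := by
    exact_mod_cast Finset.card_pos.2 ⟨c, Finset.mem_compl.2 hcM⟩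
  -- The weight taken from `M` is shared equally among all other colours: while `M` is stuck, growth
  -- of any one of them makes the product large.
  set q := d / Mᶜ.card with hq
  have hq0 : 0 < q := div_pos hd0 hcard
  set θ : Fin A → ℝ := fun i => if i ∈ M then -F i (x₀ i) else q with hθdef
  have hθ : ∑ i, θ i = 0 := by
    rw [← Finset.sum_add_sum_compl M, Finset.sum_congr rfl (g := fun i => -F i (x₀ i))
      fun i hi => if_pos hi, Finset.sum_congr rfl (g := fun _ => q)
      fun i hi => if_neg (Finset.mem_compl.1 hi), Finset.sum_neg_distrib, Finset.sum_const,
      nsmul_eq_mul, mul_div_cancel₀ _ hcard.ne', ← hd, neg_add_cancel]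
  have hθ0 : ∀ i k, x₀ i ≤ k → 0 ≤ 1 + θ i / F i k := by
    intro i k hk
    have hpos := hF i k ((hx₀ i).trans hk)
    by_cases hi : i ∈ M
    · simp only [hθdef, if_pos hi, neg_div]
      linarith [(div_le_one hpos).2 (hle i hi k hk)]
    · simp only [hθdef, if_neg hi]
      positivity
  have hgrow : ∀ (R : ℝ) (j : Fin A), ∃ N, j ∉ M → ∀ m, N ≤ m →
      R ≤ ∏ k ∈ Finset.Ico (x₀ j) m, (1 + θ j / F j k) := by
    intro R j
    by_cases hj : j ∈ M
    · exact ⟨0, fun h => absurd hj h⟩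
    obtain ⟨N, hN⟩ := eventually_atTop.1
      ((tendsto_sum_inv_of_not_explosive (hF j) (hexp j hj) (hx₀ j)).eventually_ge_atTop (R / q))
    refine ⟨N, fun _ m hm => ?_⟩
    have h1 := one_add_sum_le_prod (hF j) hq0.le (hx₀ j) m
    have h2 := (div_le_iff₀' hq0).1 (hN m hm)
    simp only [hθdef, if_neg hj]
    linarith
  refine ENNReal.tendsto_nhds_zero.2 fun ε hε => ?_
  obtain ⟨r, hr0, hrε⟩ := ENNReal.lt_iff_exists_nnreal_btwn.1 hε
  have hr0' : 0 < r := ENNReal.coe_pos.1 hr0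
  choose N hN using hgrow (max 1 (r : ℝ)⁻¹)
  -- Pigeonhole: if `M` is stuck after more than `∑ N j` draws, some `j ∉ M` has at least `N j`
  -- balls.
  filter_upwards [eventually_gt_atTop (∑ j, N j)] with n hn
  have h := hX.mul_measure_le_one hF hx₀ c hθ hθ0 n (Q := fun v => ∀ i ∈ M, v i = x₀ i)
    (R := max 1 (r : ℝ)⁻¹) ?_
  · refine le_trans ?_ hrε.le
    have h1 : ENNReal.ofReal (r : ℝ)⁻¹ * P {ω | ∀ i ∈ M, X n ω i = x₀ i} ≤ 1 :=
      le_trans (mul_le_mul_left (ENNReal.ofReal_le_ofReal (le_max_right _ _)) _) h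
    rw [ENNReal.ofReal_inv_of_pos (by exact_mod_cast hr0'), ENNReal.ofReal_coe_nnreal] at h1
    have h2 := mul_le_mul_right h1 (r : ENNReal)
    rwa [← mul_assoc, ENNReal.mul_inv_cancel hr0.ne' ENNReal.coe_ne_top, one_mul, mul_one] at h2
  · intro v hv hsum hstuck
    obtain ⟨j, hjM, hj⟩ : ∃ j, j ∉ M ∧ N j ≤ v j := by
      by_contra! hcon
      have : ∑ i, v i ≤ ∑ i, (x₀ i + N i) := by
        refine Finset.sum_le_sum fun i _ => ?_
        by_cases hi : i ∈ M
        · rw [hstuck i hi]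
          exact le_self_add
        · exact (hcon i hi).le.trans le_add_self
      rw [hsum, Finset.sum_add_distrib] at this
      omega
    calc max 1 (r : ℝ)⁻¹ = ∏ i, if i = j then max 1 (r : ℝ)⁻¹ else 1 := by simp
      _ ≤ growthProd F x₀ θ v := by
        refine Finset.prod_le_prod (fun i _ => by split_ifs <;> positivity) fun i _ => ?_
        split_ifs with hij
        · subst hij
          exact hN i hjM _ hj
        · by_cases hi : i ∈ M
          · rw [hstuck i hi]
            simp
          · have h1 := one_add_sum_le_prod (hF i) hq0.le (hx₀ i) (v i)
            have h2 : 0 ≤ ∑ k ∈ Finset.Ico (x₀ i) (v i), 1 / F i k :=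
              Finset.sum_nonneg fun k hk =>
                one_div_nonneg.2 (hF i k ((hx₀ i).trans (Finset.mem_Ico.1 hk).1)).le
            simp only [hθdef, if_neg hi]
            nlinarith [mul_nonneg hq0.le h2]

/-- Lower bound for the tail of the final count of a colour outside `M`. -/
theorem IsPolyaUrn.one_le_mul_tail [IsProbabilityMeasure P] (hX : IsPolyaUrn P F x₀ X)
    (hF : ∀ i, IsFeedback (F i)) (hx₀ : ∀ i, 1 ≤ x₀ i) {c : Fin A} {M : Finset (Fin A)}
    (hM : M.Nonempty) (hcM : c ∉ M) (hexp : ∀ j, j ∉ M → ¬ SatisfiesExplosion (F j))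
    (hle : ∀ i ∈ M, ∀ k, x₀ i ≤ k → F i (x₀ i) ≤ F i k) {x : ℕ} (hx : x₀ c ≤ x) :
    1 ≤ (∏ k ∈ Finset.Icc (x₀ c) x, (1 + (∑ i ∈ M, F i (x₀ i)) / F c k)) *
      P.real {ω | (x : ℕ∞) < finalCount X c ω} := by
  set d := ∑ i ∈ M, F i (x₀ i) with hd
  have hd0 : 0 < d := Finset.sum_pos (fun i _ => hF i _ (hx₀ i)) hM
  -- For `i ∈ M` the factor at `k = x₀ i` is exactly zero, so one draw from `M` kills the product.
  set θ : Fin A → ℝ := fun i => (if i ∈ M then -F i (x₀ i) else 0) + if i = c then d else 0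
    with hθdef
  have hθM : ∀ i ∈ M, θ i = -F i (x₀ i) := fun i hi => by
    simp [hθdef, hi, ne_of_mem_of_not_mem hi hcM]
  have hθc : θ c = d := by simp [hθdef, hcM]
  have hθn : ∀ i, i ∉ M → i ≠ c → θ i = 0 := fun i hi hic => by simp [hθdef, hi, hic]
  have hθ : ∑ i, θ i = 0 := by
    simp only [hθdef, Finset.sum_add_distrib, Finset.sum_ite_mem, Finset.univ_inter,
      Finset.sum_neg_distrib, Finset.sum_ite_eq', Finset.mem_univ, if_true]
    rw [← hd, neg_add_cancel]
  have hposc : ∀ k, x₀ c ≤ k → 1 ≤ 1 + d / F c k := fun k hk => by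
    have := hF c k ((hx₀ c).trans hk)
    exact le_add_of_nonneg_right (by positivity)
  have hθ0 : ∀ i k, x₀ i ≤ k → 0 ≤ 1 + θ i / F i k := by
    intro i k hk
    have hpos := hF i k ((hx₀ i).trans hk)
    by_cases hi : i ∈ M
    · rw [hθM i hi, neg_div]
      linarith [(div_le_one hpos).2 (hle i hi k hk)]
    · by_cases hic : i = c
      · subst hic
        rw [hθc]
        exact zero_le_one.trans (hposc k hk)
      · simp [hθn i hi hic]
  set H : ℕ → ℝ := fun m => ∏ k ∈ Finset.Ico (x₀ c) m, (1 + d / F c k) with hH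
  have hH1 : ∀ m, 0 ≤ H m := fun m =>
    Finset.prod_nonneg fun k hk => zero_le_one.trans (hposc k (Finset.mem_Ico.1 hk).1)
  have hHmono : Monotone H := by
    refine monotone_nat_of_le_succ fun m => ?_
    rcases le_or_gt (x₀ c) m with h | h
    · simp only [hH]
      rw [Finset.prod_Ico_succ_top h]
      exact le_mul_of_one_le_right (hH1 m) (hposc m h)
    · simp only [hH]
      rw [Finset.Ico_eq_empty_of_le (show m + 1 ≤ x₀ c from h), Finset.Ico_eq_empty_of_le h.le]
  have hGle : ∀ v, growthProd F x₀ θ v ≤ H (v c) := by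
    intro v
    calc growthProd F x₀ θ v ≤ ∏ i, if i = c then H (v c) else 1 := by
          refine Finset.prod_le_prod (fun i _ => Finset.prod_nonneg fun k hk =>
            hθ0 i k (Finset.mem_Ico.1 hk).1) fun i _ => ?_
          split_ifs with hic
          · subst hic
            simp only [hθc, hH, le_refl]
          · refine Finset.prod_le_one (fun k hk => hθ0 i k (Finset.mem_Ico.1 hk).1) fun k hk => ?_
            by_cases hi : i ∈ M
            · rw [hθM i hi, neg_div]
              have := hF i _ (hx₀ i)
              have := hF i k ((hx₀ i).trans (Finset.mem_Ico.1 hk).1)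
              exact add_le_of_nonpos_right (neg_nonpos.2 (by positivity))
            · simp [hθn i hi hic]
      _ = H (v c) := by simp
  have hG0 : ∀ v, x₀ ≤ v → ¬ (∀ i ∈ M, v i = x₀ i) → growthProd F x₀ θ v = 0 := by
    intro v hv hns
    push Not at hns
    obtain ⟨i, hi, hne⟩ := hns
    refine Finset.prod_eq_zero (Finset.mem_univ i) (Finset.prod_eq_zero (i := x₀ i)
      (Finset.mem_Ico.2 ⟨le_rfl, lt_of_le_of_ne (hv i) (Ne.symm hne)⟩) ?_)
    rw [hθM i hi, neg_div, div_self (hF i _ (hx₀ i)).ne', add_neg_cancel]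
  -- Freezing at `H (x + 1)`, the largest value the product can have when `v c` first reaches `x +
  -- 1`, preserves subharmonicity.
  set g : (Fin A → ℕ) → ℝ := fun v => if x < v c then H (x + 1) else growthProd F x₀ θ v with hg
  have hg0 : ∀ v, 0 ≤ g v := fun v => by
    simp only [hg]
    split_ifs
    · exact hH1 _
    · exact growthProd_nonneg hθ0 v
  have hsub : ∀ v, x₀ ≤ v →
      (∑ j, F j (v j)) * g v ≤ ∑ i, F i (v i) * g (v + Pi.single i 1) := by
    intro v hv
    by_cases hvx : x < v c
    · have h1 : ∀ i, g (v + Pi.single i 1) = H (x + 1) := fun i =>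
        if_pos (hvx.trans_le (Nat.le_add_right _ _))
      simp only [h1, ← Finset.sum_mul]
      simp only [hg, if_pos hvx, le_refl]
    · have h1 : g v = growthProd F x₀ θ v := if_neg hvx
      rw [h1, ← sum_mul_growthProd_add_single hF hx₀ hθ hv]
      refine Finset.sum_le_sum fun i _ =>
        mul_le_mul_of_nonneg_left ?_ (hF i _ ((hx₀ i).trans (hv i))).le
      simp only [hg]
      split_ifs with hlt
      · refine (hGle _).trans (hHmono ?_)
        have : (Pi.single i 1 : Fin A → ℕ) c ≤ 1 := by
          by_cases hic : c = i
          · subst hic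
            simp
          · simp [hic]
        rw [Pi.add_apply]
        omega
      · exact le_rfl
  have hstep : ∀ n, 1 ≤ ENNReal.ofReal (H (x + 1)) *
      (P {ω | (x : ℕ∞) < finalCount X c ω} + P {ω | ∀ i ∈ M, X n ω i = x₀ i}) := by
    intro n
    have h := hX.le_lintegral_of_subharmonic hF hx₀ c g (fun v _ => hg0 v) hsub n
    have hgx : g x₀ = 1 := by
      simp only [hg, if_neg hx.not_gt, growthProd_self]
    rw [hgx, ENNReal.ofReal_one] at h
    set E := {ω | x < X n ω c} with hE
    set S := {ω | ∀ i ∈ M, X n ω i = x₀ i} with hS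
    have hEm : MeasurableSet E :=
      hX.measurable n (MeasurableSet.of_discrete (s := {v : Fin A → ℕ | x < v c}))
    have hSm : MeasurableSet S :=
      hX.measurable n (MeasurableSet.of_discrete (s := {v : Fin A → ℕ | ∀ i ∈ M, v i = x₀ i}))
    calc (1 : ENNReal) ≤ ∫⁻ ω, ENNReal.ofReal (g (X n ω)) ∂P := h
      _ ≤ ∫⁻ ω, (E.indicator (fun _ => ENNReal.ofReal (H (x + 1))) ω +
            S.indicator (fun _ => ENNReal.ofReal (H (x + 1))) ω) ∂P := by
          refine lintegral_mono_ae ?_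
          filter_upwards [hX.ae_path hF hx₀ c] with ω hω
          by_cases hωE : ω ∈ E
          · rw [Set.indicator_of_mem hωE]
            simp only [hg, if_pos (show x < X n ω c from hωE)]
            exact le_self_add
          · rw [Set.indicator_of_notMem hωE, zero_add]
            have hωE : ¬ x < X n ω c := hωE
            simp only [hg, if_neg hωE]
            by_cases hωS : ω ∈ S
            · rw [Set.indicator_of_mem hωS]
              exact ENNReal.ofReal_le_ofReal ((hGle _).trans (hHmono (by omega)))
            · rw [hG0 _ (hω.2 n).1 hωS, ENNReal.ofReal_zero]
              exact zero_le
      _ = ENNReal.ofReal (H (x + 1)) * (P E + P S) := by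
          rw [lintegral_add_left (measurable_const.indicator hEm),
            lintegral_indicator_const hEm, lintegral_indicator_const hSm, mul_add]
      _ ≤ _ := by
          rw [finalCount_tail_eq]
          gcongr
          exact Set.subset_iUnion (fun n => {ω | x < X n ω c}) n
  have hlim : Tendsto (fun n => ENNReal.ofReal (H (x + 1)) *
      (P {ω | (x : ℕ∞) < finalCount X c ω} + P {ω | ∀ i ∈ M, X n ω i = x₀ i})) atTop
      (𝓝 (ENNReal.ofReal (H (x + 1)) * (P {ω | (x : ℕ∞) < finalCount X c ω} + 0))) :=
    ENNReal.Tendsto.const_mul (tendsto_const_nhds.add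
      (hX.tendsto_measure_stuck hF hx₀ hM hcM hexp hle)) (Or.inr ENNReal.ofReal_ne_top)
  have hfin := ge_of_tendsto' hlim hstep
  rw [add_zero, ← ofReal_measureReal (measure_ne_top _ _), ← ENNReal.ofReal_mul (hH1 _),
    ENNReal.one_le_ofReal] at hfin
  exact hfin

/-- Upper bound for the tail of the final count of a colour outside `M`. -/
theorem IsPolyaUrn.exists_mul_tail_le_one [IsProbabilityMeasure P] (hX : IsPolyaUrn P F x₀ X)
    (hF : ∀ i, IsFeedback (F i)) (hx₀ : ∀ i, 1 ≤ x₀ i) {c : Fin A} {M : Finset (Fin A)}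
    (hM : M.Nonempty) (hcM : c ∉ M) (hexp : ∀ i ∈ M, SatisfiesExplosion (F i))
    (hle : ∀ i ∈ M, ∀ k, x₀ i ≤ k → F i (x₀ i) ≤ F i k) {s : ℝ} (hs0 : 0 ≤ s) (hs1 : s < 1) :
    ∃ b, 0 < b ∧ ∀ x,
      b * (∏ k ∈ Finset.Icc (x₀ c) x, (1 + s * (∑ i ∈ M, F i (x₀ i)) / F c k)) *
        P.real {ω | (x : ℕ∞) < finalCount X c ω} ≤ 1 := by
  set d := ∑ i ∈ M, F i (x₀ i) with hd
  have hd0 : 0 < d := Finset.sum_pos (fun i _ => hF i _ (hx₀ i)) hM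
  set θ : Fin A → ℝ := fun i =>
    (if i ∈ M then -(s * F i (x₀ i)) else 0) + if i = c then s * d else 0 with hθdef
  have hθM : ∀ i ∈ M, θ i = -(s * F i (x₀ i)) := fun i hi => by
    simp [hθdef, hi, ne_of_mem_of_not_mem hi hcM]
  have hθc : θ c = s * d := by simp [hθdef, hcM]
  have hθn : ∀ i, i ∉ M → i ≠ c → θ i = 0 := fun i hi hic => by simp [hθdef, hi, hic]
  have hθ : ∑ i, θ i = 0 := by
    simp only [hθdef, Finset.sum_add_distrib, Finset.sum_ite_mem, Finset.univ_inter,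
      Finset.sum_neg_distrib, Finset.sum_ite_eq', Finset.mem_univ, if_true, ← Finset.mul_sum]
    rw [← hd, neg_add_cancel]
  have hposc : ∀ k, x₀ c ≤ k → 1 ≤ 1 + s * d / F c k := fun k hk => by
    have := hF c k ((hx₀ c).trans hk)
    exact le_add_of_nonneg_right (by positivity)
  have hθ0 : ∀ i k, x₀ i ≤ k → 0 ≤ 1 + θ i / F i k := by
    intro i k hk
    have hpos := hF i k ((hx₀ i).trans hk)
    by_cases hi : i ∈ M
    · rw [hθM i hi, neg_div]
      have := hF i _ (hx₀ i)
      have : s * F i (x₀ i) ≤ F i k := by nlinarith [hle i hi k hk]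
      linarith [(div_le_one hpos).2 this]
    · by_cases hic : i = c
      · subst hic
        rw [hθc]
        exact zero_le_one.trans (hposc k hk)
      · simp [hθn i hi hic]
  -- Only explosive factors can fall below one; colours outside `M` other than `c` have weight zero.
  have hB : ∀ i, ∃ b, 0 < b ∧ (i ≠ c → ∀ m, b ≤ ∏ k ∈ Finset.Ico (x₀ i) m, (1 + θ i / F i k)) := by
    intro i
    by_cases hi : i ∈ M
    · have hpos := hF i _ (hx₀ i)
      obtain ⟨b, hb, h⟩ := exists_pos_le_prod_of_explosive (hF i) (hexp i hi) (hx₀ i) (hle i hi)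
        (mul_nonneg hs0 hpos.le) (mul_lt_of_lt_one_left hpos hs1)
      refine ⟨b, hb, fun _ m => ?_⟩
      rw [hθM i hi]
      exact h m
    · exact ⟨1, one_pos, fun hic m => by simp [hθn i hi hic]⟩
  choose B hB0 hB using hB
  refine ⟨∏ i ∈ Finset.univ.erase c, B i, Finset.prod_pos fun i _ => hB0 i, fun x => ?_⟩
  set b := ∏ i ∈ Finset.univ.erase c, B i with hb
  have hb0 : 0 < b := Finset.prod_pos fun i _ => hB0 i
  set H := ∏ k ∈ Finset.Icc (x₀ c) x, (1 + s * d / F c k) with hH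
  have hH0 : 0 ≤ H :=
    Finset.prod_nonneg fun k hk => zero_le_one.trans (hposc k (Finset.mem_Icc.1 hk).1)
  have hstep : ∀ n, ENNReal.ofReal (b * H) * P {ω | x < X n ω c} ≤ 1 := by
    intro n
    refine hX.mul_measure_le_one hF hx₀ c hθ hθ0 n (Q := fun v => x < v c) fun v _ _ hxv => ?_
    rw [growthProd, ← Finset.mul_prod_erase _ _ (Finset.mem_univ c), mul_comm b]
    refine mul_le_mul ?_ (Finset.prod_le_prod (fun i _ => (hB0 i).le) fun i hi =>
      hB i (Finset.ne_of_mem_erase hi) _) hb0.le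
      (Finset.prod_nonneg fun k hk => hθ0 c k (Finset.mem_Ico.1 hk).1)
    simp only [hθc]
    refine Finset.prod_le_prod_of_subset_of_one_le ?_ ?_ ?_
    · intro k hk
      have := Finset.mem_Icc.1 hk
      exact Finset.mem_Ico.2 ⟨this.1, this.2.trans_lt hxv⟩
    · exact fun k hk => zero_le_one.trans (hposc k (Finset.mem_Icc.1 hk).1)
    · exact fun k hk _ => hposc k (Finset.mem_Ico.1 hk).1
  have hlim : ENNReal.ofReal (b * H) * P {ω | (x : ℕ∞) < finalCount X c ω} ≤ 1 := by
    -- Continuity from below needs increasing events, which holds only on the almost sure set of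
    -- monotone paths.
    set G := {ω | Monotone fun n => X n ω c} with hG
    have hGae : ∀ᵐ ω ∂P, ω ∈ G := by
      filter_upwards [hX.ae_path hF hx₀ c] with ω hω
      refine monotone_nat_of_le_succ fun n => ?_
      obtain ⟨i, hi⟩ := (hω.2 n).2
      rw [hi]
      exact Nat.le_add_right _ _
    have hE : ∀ E : Set Ω, P E = P (E ∩ G) := fun E => by
      refine measure_congr ?_
      filter_upwards [hGae] with ω hω
      exact propext ⟨fun h => ⟨h, hω⟩, fun h => h.1⟩
    have hmonoE : Monotone fun n => {ω | x < X n ω c} ∩ G := fun m n hmn ω hω =>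
      ⟨lt_of_lt_of_le (show x < X m ω c from hω.1) (hω.2 hmn), hω.2⟩
    rw [finalCount_tail_eq, hE, Set.iUnion_inter, hmonoE.measure_iUnion, ENNReal.mul_iSup]
    refine iSup_le fun n => ?_
    rw [← hE]
    exact hstep n
  rw [← ofReal_measureReal (measure_ne_top _ _), ← ENNReal.ofReal_mul (mul_nonneg hb0.le hH0),
    ENNReal.ofReal_le_one] at hlim
  exact hlim

end Tail

/-! ### Logarithms of the products and the conclusion. -/

/-- With `y = θ / f k`, `log (1 + y) ≥ y / (1 + y) ≥ s * y` once `y ≤ 1 - s`, which holds eventually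
because `f → ∞`; `C` absorbs the remaining indices. -/
theorem exists_sub_le_log_prod {f : ℕ → ℝ} (hf : IsFeedback f) (hlim : Tendsto f atTop atTop)
    {θ : ℝ} (hθ : 0 ≤ θ) {a : ℕ} (ha : 1 ≤ a) {s : ℝ} (hs0 : 0 ≤ s) (hs1 : s < 1) :
    ∃ C, ∀ x, s * θ * ∑ k ∈ Finset.Icc a x, 1 / f k - C ≤
      Real.log (∏ k ∈ Finset.Icc a x, (1 + θ / f k)) := by
  obtain ⟨K, hK⟩ := eventually_atTop.1
    ((hlim.const_div_atTop θ).eventually_le_const (sub_pos.2 hs1))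
  refine ⟨∑ k ∈ Finset.range K, |s * θ * (1 / f k)|, fun x => ?_⟩
  have hpos : ∀ k ∈ Finset.Icc a x, 0 < f k := fun k hk => hf k (ha.trans (Finset.mem_Icc.1 hk).1)
  have hy : ∀ k ∈ Finset.Icc a x, 0 ≤ θ / f k := fun k hk => div_nonneg hθ (hpos k hk).le
  have hC : ∑ k ∈ Finset.Icc a x, (if k < K then |s * θ * (1 / f k)| else 0) ≤
      ∑ k ∈ Finset.range K, |s * θ * (1 / f k)| := by
    rw [← Finset.sum_filter]
    refine Finset.sum_le_sum_of_subset_of_nonneg (fun k hk => ?_) fun _ _ _ => abs_nonneg _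
    exact Finset.mem_range.2 (Finset.mem_filter.1 hk).2
  rw [Real.log_prod fun k hk => (add_pos_of_pos_of_nonneg one_pos (hy k hk)).ne', Finset.mul_sum]
  refine (sub_le_sub_left hC _).trans ?_
  rw [← Finset.sum_sub_distrib]
  refine Finset.sum_le_sum fun k hk => ?_
  have hyk := hy k hk
  have he : s * θ * (1 / f k) = s * (θ / f k) := by ring
  split_ifs with hkK
  · exact (sub_nonpos.2 (le_abs_self _)).trans (Real.log_nonneg (le_add_of_nonneg_right hyk))
  · rw [sub_zero, he]
    have h1 : (0 : ℝ) < 1 + θ / f k := by linarith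
    refine le_trans ?_ (Real.one_sub_inv_le_log_of_pos h1)
    have h2 : 1 - (1 + θ / f k)⁻¹ = θ / f k / (1 + θ / f k) := by
      rw [eq_div_iff h1.ne', sub_mul, inv_mul_cancel₀ h1.ne']
      ring
    rw [h2, le_div_iff₀ h1]
    have h3 := hK k (not_lt.1 hkK)
    -- `s * (1 + y) ≤ s * (2 - s) ≤ 1`, the last step being `(1 - s) ^ 2 ≥ 0`.
    nlinarith [mul_le_mul_of_nonneg_left h3 hs0, mul_nonneg hs0 hyk, sq_nonneg (1 - s)]

theorem log_prod_le {f : ℕ → ℝ} (hf : IsFeedback f) {θ : ℝ} (hθ : 0 ≤ θ) {a : ℕ} (ha : 1 ≤ a)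
    (x : ℕ) : Real.log (∏ k ∈ Finset.Icc a x, (1 + θ / f k)) ≤
      θ * ∑ k ∈ Finset.Icc a x, 1 / f k := by
  have hy : ∀ k ∈ Finset.Icc a x, 0 ≤ θ / f k := fun k hk =>
    div_nonneg hθ (hf k (ha.trans (Finset.mem_Icc.1 hk).1)).le
  rw [Real.log_prod fun k hk => (add_pos_of_pos_of_nonneg one_pos (hy k hk)).ne', Finset.mul_sum]
  refine Finset.sum_le_sum fun k hk => ?_
  rw [mul_one_div]
  linarith [Real.log_le_sub_one_of_pos (add_pos_of_pos_of_nonneg one_pos (hy k hk))]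

/-- Tail of the final number of balls of a non-explosive colour `c` of a generalized Pólya urn. -/
theorem mainTheorem4 {A : ℕ} {Ω : Type*} [MeasurableSpace Ω]
    (P : Measure Ω) [IsProbabilityMeasure P]
    (F : Fin A → ℕ → ℝ) (hF : ∀ i, IsFeedback (F i))
    (x₀ : Fin A → ℕ) (hx₀ : ∀ i, 1 ≤ x₀ i)
    (X : ℕ → Ω → Fin A → ℕ) (hX : IsPolyaUrn P F x₀ X)
    (c : Fin A)
    (hM : (explosiveColours F).Nonempty)
    (hc : c ∉ explosiveColours F)
    (hlim : Tendsto (F c) atTop atTop)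
    (hmono : ∀ i ∈ explosiveColours F, IsStrictlyMonotone (F i)) :
    Tendsto
      (fun x : ℕ =>
        -Real.log (P.real {ω | (x : ℕ∞) < finalCount X c ω}) /
          ((∑ i ∈ explosiveColours F, F i (x₀ i)) * ∑ k ∈ Finset.Icc (x₀ c) x, 1 / F c k))
      atTop (𝓝 1) := by
  have hmem : ∀ i, i ∈ explosiveColours F ↔ SatisfiesExplosion (F i) := fun i => by
    simp [explosiveColours]
  have hexp : ∀ i ∈ explosiveColours F, SatisfiesExplosion (F i) := fun i => (hmem i).1
  have hnexp : ∀ i, i ∉ explosiveColours F → ¬ SatisfiesExplosion (F i) := fun i hi h =>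
    hi ((hmem i).2 h)
  have hle : ∀ i ∈ explosiveColours F, ∀ k, x₀ i ≤ k → F i (x₀ i) ≤ F i k := fun i hi k hk =>
    (hmono i hi).le_of_explosive (hF i) (hexp i hi) (hx₀ i) hk
  have hlow := fun {x : ℕ} (hx : x₀ c ≤ x) => hX.one_le_mul_tail hF hx₀ hM hc hnexp hle hx
  have hup := fun {s : ℝ} (hs0 : 0 ≤ s) (hs1 : s < 1) =>
    hX.exists_mul_tail_le_one hF hx₀ hM hc hexp hle hs0 hs1
  set d := ∑ i ∈ explosiveColours F, F i (x₀ i) with hd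
  have hd0 : 0 < d := Finset.sum_pos (fun i _ => hF i _ (hx₀ i)) hM
  set S : ℕ → ℝ := fun x => ∑ k ∈ Finset.Icc (x₀ c) x, 1 / F c k with hS
  set p : ℕ → ℝ := fun x => P.real {ω | (x : ℕ∞) < finalCount X c ω} with hp
  have hprod : ∀ θ : ℝ, 0 ≤ θ → ∀ x, 0 < ∏ k ∈ Finset.Icc (x₀ c) x, (1 + θ / F c k) :=
    fun θ hθ x => Finset.prod_pos fun k hk => by
      have := hF c k ((hx₀ c).trans (Finset.mem_Icc.1 hk).1)
      positivity
  have hS_lim : Tendsto S atTop atTop := by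
    have h := (tendsto_sum_inv_of_not_explosive (hF c) (hnexp c hc) (hx₀ c)).comp
      (tendsto_add_atTop_nat 1)
    refine h.congr fun x => Finset.sum_congr ?_ fun _ _ => rfl
    ext k
    simp only [Finset.mem_Ico, Finset.mem_Icc]
    omega
  have hp0 : ∀ x, x₀ c ≤ x → 0 < p x := fun x hx => by
    have h := hlow hx
    by_contra hcon
    have : p x = 0 := le_antisymm (not_lt.1 hcon) measureReal_nonneg
    simp only [hp] at this
    rw [this, mul_zero] at h
    linarith
  have hupper : ∀ x, x₀ c ≤ x → -Real.log (p x) ≤ d * S x := fun x hx => by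
    have h := Real.log_nonneg (hlow hx)
    rw [Real.log_mul (hprod d hd0.le x).ne' (hp0 x hx).ne'] at h
    linarith [log_prod_le (hF c) hd0.le (hx₀ c) x]
  refine tendsto_order.2 ⟨fun l hl => ?_, fun u hu => ?_⟩
  · set m := max l 0 with hm
    have hm0 : 0 ≤ m := le_max_right _ _
    have hm1 : m < 1 := max_lt hl one_pos
    have hlm : l ≤ m := le_max_left _ _
    -- One factor `s` is lost in the scaled weights and one in the logarithm; `s * s - m = (1 - m) ^
    -- 2 / 4 > 0` leaves room for both.
    set s := (1 + m) / 2 with hs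
    have hs0 : 0 ≤ s := by linarith
    have hs1 : s < 1 := by linarith
    have hls : l < s * s := by nlinarith [mul_pos (sub_pos.2 hm1) (sub_pos.2 hm1)]
    obtain ⟨b, hb0, hb⟩ := hup hs0 hs1
    have hsd : 0 ≤ s * d := mul_nonneg hs0 hd0.le
    obtain ⟨C, hC⟩ := exists_sub_le_log_prod (hF c) hlim hsd (hx₀ c) hs0 hs1
    filter_upwards [eventually_ge_atTop (x₀ c), hS_lim.eventually_gt_atTop 0,
      (hS_lim.const_mul_atTop (mul_pos (sub_pos.2 hls) hd0)).eventually_gt_atTop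
        (C - Real.log b)] with x hx hSx hlarge
    rw [lt_div_iff₀ (mul_pos hd0 hSx)]
    have h := Real.log_nonpos (mul_nonneg (mul_pos hb0 (hprod _ hsd x)).le measureReal_nonneg)
      (hb x)
    rw [Real.log_mul (mul_pos hb0 (hprod _ hsd x)).ne' (hp0 x hx).ne',
      Real.log_mul hb0.ne' (hprod _ hsd x).ne'] at h
    have h' := hC x
    simp only [hp, hS] at *
    linarith
  · filter_upwards [eventually_ge_atTop (x₀ c), hS_lim.eventually_gt_atTop 0] with x hx hSx
    exact ((div_le_one (mul_pos hd0 hSx)).2 (hupper x hx)).trans_lt hu
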